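/- Definitions. A \emph{path} is a simple curve in the plane made up of alternating horizontal and vertical line segments; a \emph{$k$-bend path} is a path with at most $k+1$ segments. The \emph{bend number} $bend(G)$ of a graph $G$ is the least $k\ge 0$ such that the vertices of $G$ can be represented by $k$-bend paths, two of which (for distinct vertices) intersect if and only if the vertices are adjacent. The \emph{dimension} of a poset is the least number of linear orders on its ground set whose intersection is the poset. A graph $G$ is a \emph{cocomparability graph} if its complement is the comparability graph of a poset (two distinct elements being adjacent iff they are comparable), and $dim(G)$ is then the dimension of any such poset (it does not depend on the choice of the poset). For $1\le r<s\le n-1$, $P(r,s;n)$ denotes the poset of all $r$-element and all $s$-element subsets of $\{1,\dots,n\}$, ordered by inclusion. Theorem. For all $t,m\in\mathbb{N}$ there exists a cocomparability graph $G_{t,m}$ with $$t<bend(G_{t,m})\le 4t+29\qquad\text{and}\qquad dim(G_{t,m})-bend(G_{t,m})>m.$$ Moreover, with $k=2t+16$, the graph $G_{t,m}$ can be taken to be the complement of the comparability graph of $P(k,n-1;n)$ for some $n>k+1$. -/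

import Mathlib

/-! ### Posets, dimension, comparability graphs -/

/-- The comparability graph of a partial order `P` on `X`: distinct `u`, `v` are adjacent iff they
are comparable. -/
def comparabilityGraph {X : Type*} (P : PartialOrder X) : SimpleGraph X where
  Adj u v := P.lt u v ∨ P.lt v u
  symm := ⟨fun _ _ h => h.symm⟩
  loopless := ⟨fun u h => h.elim (lt_irrefl u) (lt_irrefl u)⟩

/-- `L 0, …, L (d - 1)` is a realizer of `P`: the intersection of these linear orders is `P`. -/
def IsRealizer {X : Type*} (P : PartialOrder X) {d : ℕ} (L : Fin d → LinearOrder X) : Prop :=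
  ∀ x y : X, P.lt x y ↔ ∀ i, (L i).lt x y

/-- The dimension of a poset: the least size of a (non-empty) realizer. -/
noncomputable def posetDim {X : Type*} (P : PartialOrder X) : ℕ :=
  sInf {d : ℕ | 0 < d ∧ ∃ L : Fin d → LinearOrder X, IsRealizer P L}

/-- A cocomparability graph: its complement is the comparability graph of a poset. -/
def IsCocomparabilityGraph {V : Type*} (G : SimpleGraph V) : Prop :=
  ∃ P : PartialOrder V, comparabilityGraph P = Gᶜ

/-- The poset dimension of a cocomparability graph `G`: the dimension of the posets on the vertex
set whose comparability graph is the complement of `G`. All these posets have the same dimension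
(comparability invariance); the definition takes the minimum, so that a lower bound on it is a
lower bound for every such poset, whether or not one knows the invariance. -/
noncomputable def cocompDim {V : Type*} (G : SimpleGraph V) : ℕ :=
  sInf {d : ℕ | ∃ P : PartialOrder V, comparabilityGraph P = Gᶜ ∧ d = posetDim P}

/-- The ground set of the poset `P(r, s; n)`: the `r`-element and the `s`-element subsets of an
`n`-element set. It is ordered by inclusion (the order of a subtype of `Finset (Fin n)`). -/
abbrev LayerPoset (r s n : ℕ) : Type :=
  {A : Finset (Fin n) // A.card = r ∨ A.card = s}

/-- The complement of the comparability graph of `P(r, s; n)`. -/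
def layerCocompGraph (r s n : ℕ) : SimpleGraph (LayerPoset r s n) :=
  (comparabilityGraph (inferInstance : PartialOrder (LayerPoset r s n)))ᶜ

/-! ### Rectilinear paths in the plane and the bend number -/

/-- The segment from `a` to `b` is horizontal and non-degenerate. -/
def IsHorizontalSeg (a b : ℝ × ℝ) : Prop := a.2 = b.2 ∧ a.1 ≠ b.1

/-- The segment from `a` to `b` is vertical and non-degenerate. -/
def IsVerticalSeg (a b : ℝ × ℝ) : Prop := a.1 = b.1 ∧ a.2 ≠ b.2

/-- `p 0, p 1, …, p n` are the successive corner points (end points included) of a path with `n`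
segments: a simple curve whose segments are alternately horizontal and vertical. Two consecutive
segments are perpendicular, so they always meet in their common corner only; hence the curve is
simple iff non-consecutive segments are disjoint. -/
structure IsRectilinearPath (n : ℕ) (p : ℕ → ℝ × ℝ) : Prop where
  pos : 0 < n
  axis : ∀ i < n, IsHorizontalSeg (p i) (p (i + 1)) ∨ IsVerticalSeg (p i) (p (i + 1))
  alternate : ∀ i, i + 1 < n →
    (IsHorizontalSeg (p i) (p (i + 1)) ↔ IsVerticalSeg (p (i + 1)) (p (i + 2)))
  simple : ∀ i j, i + 1 < j → j < n →
    Disjoint (segment ℝ (p i) (p (i + 1))) (segment ℝ (p j) (p (j + 1)))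

/-- `S ⊆ ℝ²` is (the point set of) a `k`-bend path: a path made up of at most `k + 1` segments. -/
def IsBendPath (k : ℕ) (S : Set (ℝ × ℝ)) : Prop :=
  ∃ (n : ℕ) (p : ℕ → ℝ × ℝ), n ≤ k + 1 ∧ IsRectilinearPath n p ∧
    S = ⋃ i ∈ Finset.range n, segment ℝ (p i) (p (i + 1))

/-- `R` is a `B_k`-VPG representation of `G`: the vertices are represented by `k`-bend paths, and
the paths of two distinct vertices intersect iff the vertices are adjacent. -/
def IsVPGRepresentation {V : Type*} (k : ℕ) (G : SimpleGraph V) (R : V → Set (ℝ × ℝ)) : Prop :=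
  (∀ v, IsBendPath k (R v)) ∧ ∀ u v, u ≠ v → ((R u ∩ R v).Nonempty ↔ G.Adj u v)

/-- The bend number of `G`: the least `k` such that `G` has a `B_k`-VPG representation (with the
value `0` if there is none, so that `0 < bend G` entails that there is one). -/
noncomputable def bend {V : Type*} (G : SimpleGraph V) : ℕ :=
  sInf {k : ℕ | ∃ R : V → Set (ℝ × ℝ), IsVPGRepresentation k G R}

/-!
Write `k = 2 * t + 16`. In the complement of the comparability graph of `P(k, n - 1; n)` the
`k`-sets form a clique, the coatoms (complements of singletons) form a clique, and a `k`-set `A` is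
adjacent to the complement of `{j}` iff `j ∈ A`. The three quantities are estimated separately, for
every `n` large enough in terms of `t` and `m`.

*Bend number at most `2 * k - 3`* (`exists_representation`). Put three consecutive copies of
`{0, …, n - 1}` on the diagonal of the plane. The complement of `{j}` is represented by a staircase
above the diagonal that touches it in the three copies of `j`. A `k`-set is represented by a
staircase below the diagonal that touches it once for each element: in the first copy for the
least element, in the third copy for the greatest one, in the second copy for the others; this takes
`2 * (k - 1)` segments. Staircases on different sides meet only in common points of the
diagonal (`stair_inter_swap_stair`), which gives the right adjacencies. Two staircases on the same
side fail to cross only if one lies inside a gap of the other, which the three copies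
prevent (`stair_inter_stair`).

*Bend number greater than `t`* (`choose_le_of_representation`). Whether two rectilinear paths meet
depends only on the order relations between the coordinates of their corners. Hence a `k`-set,
which is determined by the coatom paths that its own path meets, is determined by the positions of
`2 * (t + 2)` numbers relative to the `O(n)` corner coordinates of the coatom paths. So
there are `O(n ^ (2 * t + 4))` many `k`-sets, which is false for large `n` as `k > 2 * t + 4`.

*Dimension at least `n / k`* (`le_cocompDim_mul`). In a linear extension, the complement of `{j}`
can precede a `k`-set that contains `j` only if it is among the first `k` coatoms. In a realizer
this happens for every `j`, so `d` orders realize at most `d * k` coatoms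
(`le_mul_of_realizes`). This applies to every poset with the same comparability graph, since such a
poset is the inclusion order or its dual (`orientation_of_comparabilityGraph_eq`).
-/

/-! ### Axis-parallel segments and staircases -/

theorem segment_eq_uIcc_prod {a b : ℝ × ℝ} (h : a.1 = b.1 ∨ a.2 = b.2) :
    segment ℝ a b = Set.uIcc a.1 b.1 ×ˢ Set.uIcc a.2 b.2 := by
  obtain ⟨a1, a2⟩ := a
  obtain ⟨b1, b2⟩ := b
  rcases h with h | h <;> simp only at h <;> subst h
  · rw [← Prod.image_mk_segment_right, segment_eq_uIcc]
    ext ⟨x, y⟩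
    simp only [Set.mem_image, Prod.mk.injEq, Set.mem_prod, Set.uIcc_self, Set.mem_singleton_iff]
    constructor
    · rintro ⟨z, hz, rfl, rfl⟩
      exact ⟨rfl, hz⟩
    · rintro ⟨rfl, hz⟩
      exact ⟨y, hz, rfl, rfl⟩
  · rw [← Prod.image_mk_segment_left, segment_eq_uIcc]
    ext ⟨x, y⟩
    simp only [Set.mem_image, Prod.mk.injEq, Set.mem_prod, Set.uIcc_self, Set.mem_singleton_iff]
    constructor
    · rintro ⟨z, hz, rfl, rfl⟩
      exact ⟨hz, rfl⟩
    · rintro ⟨hz, rfl⟩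
      exact ⟨x, hz, rfl, rfl⟩

theorem IsRectilinearPath.segment_eq {n : ℕ} {p : ℕ → ℝ × ℝ} (hp : IsRectilinearPath n p)
    {i : ℕ} (hi : i < n) :
    segment ℝ (p i) (p (i + 1)) =
      Set.uIcc (p i).1 (p (i + 1)).1 ×ˢ Set.uIcc (p i).2 (p (i + 1)).2 :=
  segment_eq_uIcc_prod ((hp.axis i hi).elim (fun h => Or.inr h.1) fun h => Or.inl h.1)

theorem IsBendPath.mono {k l : ℕ} (hkl : k ≤ l) {S : Set (ℝ × ℝ)} (h : IsBendPath k S) :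
    IsBendPath l S := by
  obtain ⟨n, p, hn, hp, hS⟩ := h
  exact ⟨n, p, by omega, hp, hS⟩

theorem mem_segment_swap {a b q : ℝ × ℝ} :
    q ∈ segment ℝ a.swap b.swap ↔ q.swap ∈ segment ℝ a b := by
  constructor <;> rintro ⟨s, r, hs, hr, hsr, h⟩ <;> refine ⟨s, r, hs, hr, hsr, ?_⟩
  · rw [← h]; rfl
  · rw [← Prod.swap_swap q, ← h]; rfl

/-- Reflection in the diagonal exchanges horizontal and vertical segments, so it preserves
bend paths. -/
theorem IsBendPath.swap {k : ℕ} {S : Set (ℝ × ℝ)} (h : IsBendPath k S) :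
    IsBendPath k (Prod.swap ⁻¹' S) := by
  obtain ⟨n, p, hn, hp, rfl⟩ := h
  refine ⟨n, fun i => (p i).swap, hn, ⟨hp.pos, fun i hi => (hp.axis i hi).symm, ?_, ?_⟩, ?_⟩
  · intro i hi
    have h1 := hp.axis i (by omega)
    have h2 := hp.axis (i + 1) (by omega)
    have h3 := hp.alternate i hi
    simp only [IsHorizontalSeg, IsVerticalSeg, Prod.fst_swap, Prod.snd_swap] at *
    tauto
  · intro i j hij hj
    have := hp.simple i j hij hj
    rw [Set.disjoint_left] at this ⊢
    exact fun q h1 h2 => this (mem_segment_swap.1 h1) (mem_segment_swap.1 h2)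
  · ext q
    simp only [Set.mem_preimage, Set.mem_iUnion, mem_segment_swap]

/-- The corners of the staircase that runs below the diagonal and touches it in the points
`(d 0, d 0), (d 1, d 1), …`: the even corners are these points, and the corner between
`(d a, d a)` and `(d (a + 1), d (a + 1))` is `(d (a + 1), d a)`. -/
def stairCorner (d : ℕ → ℝ) (i : ℕ) : ℝ × ℝ := (d ((i + 1) / 2), d (i / 2))

/-- The staircase below the diagonal from `(d 0, d 0)` to `(d m, d m)`. -/
def stair (d : ℕ → ℝ) (m : ℕ) : Set (ℝ × ℝ) :=
  ⋃ i ∈ Finset.range (2 * m), segment ℝ (stairCorner d i) (stairCorner d (i + 1))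

theorem stairCorner_even (d : ℕ → ℝ) (a : ℕ) : stairCorner d (2 * a) = (d a, d a) := by
  unfold stairCorner
  congr 2 <;> omega

theorem stairCorner_odd (d : ℕ → ℝ) (a : ℕ) :
    stairCorner d (2 * a + 1) = (d (a + 1), d a) := by
  unfold stairCorner
  congr 2 <;> omega

theorem segment_stairCorner_even {d : ℕ → ℝ} (hd : StrictMono d) (a : ℕ) :
    segment ℝ (stairCorner d (2 * a)) (stairCorner d (2 * a + 1)) =
      Set.Icc (d a) (d (a + 1)) ×ˢ {d a} := by
  rw [stairCorner_even, stairCorner_odd, segment_eq_uIcc_prod (by simp), Set.uIcc_self,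
    Set.uIcc_of_le (hd.monotone (Nat.le_succ a))]

theorem segment_stairCorner_odd {d : ℕ → ℝ} (hd : StrictMono d) (a : ℕ) :
    segment ℝ (stairCorner d (2 * a + 1)) (stairCorner d (2 * a + 2)) =
      {d (a + 1)} ×ˢ Set.Icc (d a) (d (a + 1)) := by
  rw [show 2 * a + 2 = 2 * (a + 1) by ring, stairCorner_even, stairCorner_odd,
    segment_eq_uIcc_prod (by simp), Set.uIcc_self,
    Set.uIcc_of_le (hd.monotone (Nat.le_succ a))]

theorem mem_stair {d : ℕ → ℝ} (hd : StrictMono d) {m : ℕ} {q : ℝ × ℝ} :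
    q ∈ stair d m ↔ ∃ a < m, (q.1 ∈ Set.Icc (d a) (d (a + 1)) ∧ q.2 = d a) ∨
      (q.1 = d (a + 1) ∧ q.2 ∈ Set.Icc (d a) (d (a + 1))) := by
  simp only [stair, Set.mem_iUnion, Finset.mem_range, exists_prop]
  constructor
  · rintro ⟨i, hi, h⟩
    obtain ⟨a, rfl | rfl⟩ := Nat.even_or_odd' i
    · rw [segment_stairCorner_even hd] at h
      exact ⟨a, by omega, Or.inl h⟩
    · rw [segment_stairCorner_odd hd] at h
      exact ⟨a, by omega, Or.inr h⟩
  · rintro ⟨a, ha, h | h⟩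
    · refine ⟨2 * a, by omega, ?_⟩
      rw [segment_stairCorner_even hd]
      exact h
    · refine ⟨2 * a + 1, by omega, ?_⟩
      rw [segment_stairCorner_odd hd]
      exact h

theorem isBendPath_stair {d : ℕ → ℝ} (hd : StrictMono d) {m : ℕ} (hm : 0 < m) {k : ℕ}
    (hk : 2 * m ≤ k + 1) : IsBendPath k (stair d m) := by
  have hlt : ∀ a, d a < d (a + 1) := fun a => hd (Nat.lt_succ_self a)
  refine ⟨2 * m, stairCorner d, hk, ⟨by omega, ?_, ?_, ?_⟩, rfl⟩
  · intro i _
    obtain ⟨a, rfl | rfl⟩ := Nat.even_or_odd' i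
    · left
      rw [stairCorner_even, stairCorner_odd]
      exact ⟨rfl, (hlt a).ne⟩
    · right
      rw [show 2 * a + 1 + 1 = 2 * (a + 1) by ring, stairCorner_even, stairCorner_odd]
      exact ⟨rfl, (hlt a).ne⟩
  · intro i _
    obtain ⟨a, rfl | rfl⟩ := Nat.even_or_odd' i
    · rw [show 2 * a + 2 = 2 * (a + 1) by ring, stairCorner_even, stairCorner_odd,
        stairCorner_even]
      exact ⟨fun _ => ⟨rfl, (hlt a).ne⟩, fun _ => ⟨rfl, (hlt a).ne⟩⟩
    · rw [show 2 * a + 1 + 1 = 2 * (a + 1) by ring,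
        show 2 * a + 1 + 2 = 2 * (a + 1) + 1 by ring, stairCorner_even, stairCorner_odd,
        stairCorner_odd]
      exact ⟨fun h => absurd rfl h.2, fun h => absurd h.1 (hlt _).ne⟩
  · -- The sum of the coordinates strictly increases along the staircase.
    have hbound : ∀ i, ∀ q ∈ segment ℝ (stairCorner d i) (stairCorner d (i + 1)),
        d ((i + 1) / 2) + d (i / 2) ≤ q.1 + q.2 ∧
          q.1 + q.2 ≤ d ((i + 2) / 2) + d ((i + 1) / 2) := by
      intro i q hq
      obtain ⟨a, rfl | rfl⟩ := Nat.even_or_odd' i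
      · rw [segment_stairCorner_even hd] at hq
        obtain ⟨⟨h1, h2⟩, h3⟩ := hq
        rw [Set.mem_singleton_iff] at h3
        rw [show (2 * a + 1) / 2 = a by omega, show (2 * a) / 2 = a by omega,
          show (2 * a + 2) / 2 = a + 1 by omega]
        constructor <;> linarith
      · rw [segment_stairCorner_odd hd] at hq
        obtain ⟨h3, ⟨h1, h2⟩⟩ := hq
        rw [Set.mem_singleton_iff] at h3
        rw [show (2 * a + 1 + 1) / 2 = a + 1 by omega, show (2 * a + 1) / 2 = a by omega,
          show (2 * a + 1 + 2) / 2 = a + 1 by omega]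
        constructor <;> linarith
    intro i j hij _
    rw [Set.disjoint_left]
    intro q hqi hqj
    have h1 := (hbound i q hqi).2
    have h2 := (hbound j q hqj).1
    rcases Nat.even_or_odd i with hi | hi
    · have h3 : d ((i + 2) / 2) ≤ d (j / 2) := hd.monotone (by omega)
      have h4 : d ((i + 1) / 2) < d ((j + 1) / 2) := hd (by obtain ⟨c, rfl⟩ := hi; omega)
      linarith
    · have h3 : d ((i + 2) / 2) < d ((j + 1) / 2) := hd (by obtain ⟨c, rfl⟩ := hi; omega)
      have h4 : d ((i + 1) / 2) ≤ d (j / 2) := hd.monotone (by omega)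
      linarith

theorem snd_le_fst_of_mem_stair {d : ℕ → ℝ} (hd : StrictMono d) {m : ℕ} {q : ℝ × ℝ}
    (hq : q ∈ stair d m) : q.2 ≤ q.1 := by
  obtain ⟨a, _, ⟨⟨h1, _⟩, h2⟩ | ⟨h1, ⟨_, h2⟩⟩⟩ := (mem_stair hd).1 hq <;> linarith

theorem diag_mem_stair {d : ℕ → ℝ} (hd : StrictMono d) {m : ℕ} (hm : 0 < m) {x : ℝ} :
    (x, x) ∈ stair d m ↔ ∃ a ≤ m, x = d a := by
  rw [mem_stair hd]
  constructor
  · rintro ⟨a, ha, ⟨_, h⟩ | ⟨h, _⟩⟩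
    · exact ⟨a, ha.le, h⟩
    · exact ⟨a + 1, ha, h⟩
  · rintro ⟨a, ha, rfl⟩
    rcases ha.lt_or_eq with h | rfl
    · exact ⟨a, h, Or.inl ⟨⟨le_rfl, (hd (Nat.lt_succ_self a)).le⟩, rfl⟩⟩
    · obtain ⟨b, rfl⟩ := Nat.exists_eq_succ_of_ne_zero hm.ne'
      exact ⟨b, Nat.lt_succ_self b, Or.inr ⟨rfl, ⟨(hd (Nat.lt_succ_self b)).le, le_rfl⟩⟩⟩

/-- A staircase below the diagonal and the mirror image of another one lie on different sides of
the diagonal, so they meet exactly where both touch it in the same point. -/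
theorem stair_inter_swap_stair {d e : ℕ → ℝ} (hd : StrictMono d) (he : StrictMono e) {m l : ℕ}
    (hm : 0 < m) (hl : 0 < l) :
    (stair d m ∩ Prod.swap ⁻¹' stair e l).Nonempty ↔ ∃ a ≤ m, ∃ b ≤ l, d a = e b := by
  constructor
  · rintro ⟨⟨x, y⟩, h1, h2⟩
    have hxy : y = x := le_antisymm (snd_le_fst_of_mem_stair hd h1)
      (snd_le_fst_of_mem_stair he h2)
    subst hxy
    obtain ⟨a, ha, h3⟩ := (diag_mem_stair hd hm).1 h1
    obtain ⟨b, hb, h4⟩ := (diag_mem_stair he hl).1 h2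
    exact ⟨a, ha, b, hb, h3.symm.trans h4⟩
  · rintro ⟨a, ha, b, hb, h⟩
    exact ⟨(d a, d a), (diag_mem_stair hd hm).2 ⟨a, ha, rfl⟩,
      (diag_mem_stair he hl).2 ⟨b, hb, h⟩⟩

/-- Two staircases on the same side of the diagonal cross when all their contacts with the
diagonal but the first are at `N` or later, their first contacts are before `N`, and the last
contact of each comes after all the inner contacts of the other. These conditions exclude that one
of them lies in the gap between two consecutive contacts of the other. -/
theorem stair_inter_stair {d e : ℕ → ℝ} (hd : StrictMono d) (he : StrictMono e) {m : ℕ}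
    {N M : ℝ} (hm : 2 ≤ m) (hd0 : d 0 < N) (he0 : e 0 < N) (hd1 : N ≤ d 1) (he1 : N ≤ e 1)
    (hdl : d (m - 1) < M) (hel : e (m - 1) < M) (hdm : M ≤ d m) (hem : M ≤ e m) :
    (stair d m ∩ stair e m).Nonempty := by
  wlog hde : d 0 ≤ e 0 generalizing d e
  · rw [Set.inter_comm]
    exact this he hd he0 hd0 he1 hd1 hel hdl hem hdm (le_of_not_ge hde)
  -- `e j` is the last contact of the second staircase that does not come after `d 1`.
  have hlast : d 1 < e (m - 1 + 1) := by
    have : d 1 ≤ d (m - 1) := hd.monotone (by omega)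
    rw [show m - 1 + 1 = m by omega]
    linarith
  have hP : ∃ b, d 1 < e (b + 1) := ⟨m - 1, hlast⟩
  classical
  have hj := Nat.find_spec hP
  set j := Nat.find hP with hjdef
  have hjm : j < m := by
    have : j ≤ m - 1 := Nat.find_min' hP hlast
    omega
  have hj' : e j ≤ d 1 := by
    rcases Nat.eq_zero_or_pos j with h0 | h0
    · rw [h0]
      linarith
    · have := Nat.find_min hP (m := j - 1) (by omega)
      rw [show j - 1 + 1 = j by omega] at this
      exact not_lt.1 this
  have h0j : d 0 ≤ e j := hde.trans (he.monotone (Nat.zero_le j))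
  exact ⟨(d 1, e j), (mem_stair hd).2 ⟨0, by omega, Or.inr ⟨rfl, h0j, hj'⟩⟩,
    (mem_stair he).2 ⟨j, hjm, Or.inl ⟨⟨hj', hj.le⟩, rfl⟩⟩⟩

/-! ### The graph of two levels -/

/-- The `k`-element set `A` as a vertex. -/
def lowVertex {k n : ℕ} (A : Finset (Fin n)) (hA : A.card = k) : LayerPoset k (n - 1) n :=
  ⟨A, Or.inl hA⟩

/-- The complement of the singleton `{j}` as a vertex. -/
def coatom {k n : ℕ} (j : Fin n) : LayerPoset k (n - 1) n :=
  ⟨{j}ᶜ, Or.inr (by rw [Finset.card_compl, Finset.card_singleton, Fintype.card_fin])⟩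

theorem layer_cases {k n : ℕ} (hn : 0 < n) (v : LayerPoset k (n - 1) n) :
    (∃ A hA, v = lowVertex A hA) ∨ ∃ j, v = coatom j := by
  obtain ⟨A, hA | hA⟩ := v
  · exact Or.inl ⟨A, hA, rfl⟩
  · right
    have h1 : Aᶜ.card = 1 := by
      rw [Finset.card_compl, Fintype.card_fin]
      omega
    obtain ⟨j, hj⟩ := Finset.card_eq_one.1 h1
    refine ⟨j, Subtype.ext ?_⟩
    change A = {j}ᶜ
    rw [← hj, compl_compl]

theorem layerCocompGraph_adj {r s n : ℕ} {u v : LayerPoset r s n} :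
    (layerCocompGraph r s n).Adj u v ↔ u ≠ v ∧ ¬ (u < v ∨ v < u) :=
  Iff.rfl

theorem layerCocompGraph_compl (r s n : ℕ) :
    (layerCocompGraph r s n)ᶜ =
      comparabilityGraph (inferInstance : PartialOrder (LayerPoset r s n)) :=
  compl_compl _

theorem not_lt_of_card_eq {r s n : ℕ} {u v : LayerPoset r s n} (h : u.1.card = v.1.card) :
    ¬ u < v := fun huv => (Finset.card_lt_card (show u.1 ⊂ v.1 from huv)).ne h

theorem card_coatom {k n : ℕ} (j : Fin n) : (coatom (k := k) j).1.card = n - 1 := by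
  rw [coatom, Finset.card_compl, Finset.card_singleton, Fintype.card_fin]

theorem coatom_injective {k n : ℕ} : Function.Injective (coatom (k := k) (n := n)) := by
  intro i j h
  have h1 : ({i}ᶜ : Finset (Fin n)) = {j}ᶜ := congrArg Subtype.val h
  exact Finset.singleton_injective (compl_injective h1)

theorem lowVertex_ne_coatom {k n : ℕ} (hkn : k + 1 < n) {A : Finset (Fin n)} (hA : A.card = k)
    (j : Fin n) : lowVertex A hA ≠ coatom j := by
  intro h
  have h1 : A.card = n - 1 := (congrArg (fun v => v.1.card) h).trans (card_coatom j)
  omega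

theorem lowVertex_lt_coatom {k n : ℕ} (hkn : k + 1 < n) {A : Finset (Fin n)} (hA : A.card = k)
    {j : Fin n} : lowVertex A hA < coatom j ↔ j ∉ A := by
  rw [lt_iff_le_and_ne, and_iff_left (lowVertex_ne_coatom hkn hA j)]
  change A ⊆ {j}ᶜ ↔ _
  rw [Finset.subset_compl_comm, Finset.singleton_subset_iff, Finset.mem_compl]

theorem not_coatom_lt_lowVertex {k n : ℕ} (hkn : k + 1 < n) {A : Finset (Fin n)}
    (hA : A.card = k) {j : Fin n} : ¬ coatom j < lowVertex A hA := by
  intro h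
  have h1 : (coatom (k := k) j).1.card < A.card := Finset.card_lt_card h
  rw [card_coatom] at h1
  omega

theorem adj_lowVertex_coatom {k n : ℕ} (hkn : k + 1 < n) {A : Finset (Fin n)} (hA : A.card = k)
    {j : Fin n} : (layerCocompGraph k (n - 1) n).Adj (lowVertex A hA) (coatom j) ↔ j ∈ A := by
  rw [layerCocompGraph_adj, lowVertex_lt_coatom hkn]
  have := lowVertex_ne_coatom hkn hA j
  have := not_coatom_lt_lowVertex hkn hA (j := j)
  tauto

theorem adj_of_card_eq {r s n : ℕ} {u v : LayerPoset r s n} (h : u.1.card = v.1.card)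
    (huv : u ≠ v) : (layerCocompGraph r s n).Adj u v :=
  layerCocompGraph_adj.2 ⟨huv, by
    rintro (h1 | h1)
    · exact not_lt_of_card_eq h h1
    · exact not_lt_of_card_eq h.symm h1⟩

/-! ### A representation by staircases -/

/-- The increasing enumeration of the finite set `A`, continued strictly increasingly above all
elements of `Fin n`. -/
def enum {n : ℕ} (A : Finset (Fin n)) (i : ℕ) : ℕ :=
  if h : i < A.card then (A.orderEmbOfFin rfl ⟨i, h⟩ : Fin n) else n + i

theorem enum_strictMono {n : ℕ} (A : Finset (Fin n)) : StrictMono (enum A) := by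
  intro i j hij
  unfold enum
  split_ifs with h1 h2 h2
  · exact (A.orderEmbOfFin rfl).strictMono (show (⟨i, h1⟩ : Fin A.card) < ⟨j, h2⟩ from hij)
  · exact (Fin.is_lt _).trans_le (Nat.le_add_right _ _)
  · omega
  · omega

theorem enum_lt {n : ℕ} (A : Finset (Fin n)) {i : ℕ} (hi : i < A.card) : enum A i < n := by
  rw [enum, dif_pos hi]
  exact Fin.is_lt _

theorem mem_iff_exists_enum {n : ℕ} (A : Finset (Fin n)) (j : Fin n) :
    j ∈ A ↔ ∃ i < A.card, enum A i = j := by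
  constructor
  · intro hj
    have : j ∈ Set.range (A.orderEmbOfFin rfl) := by
      rw [Finset.range_orderEmbOfFin]
      exact hj
    obtain ⟨i, hi⟩ := this
    refine ⟨i, i.2, ?_⟩
    rw [enum, dif_pos i.2]
    exact congrArg Fin.val hi
  · rintro ⟨i, hi, h⟩
    rw [enum, dif_pos hi] at h
    rw [← Fin.ext h]
    exact Finset.orderEmbOfFin_mem _ _ _

/-- The contacts with the diagonal of the staircase of a set `A`. The diagonal carries three
consecutive copies of `{0, …, n - 1}`; the least element of `A` is taken from the first copy, the
greatest one from the third copy, and all others from the second copy. -/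
def lowContact {n : ℕ} (A : Finset (Fin n)) (i : ℕ) : ℕ :=
  enum A i + n * ((if 1 ≤ i then 1 else 0) + if A.card ≤ i + 1 then 1 else 0)

theorem lowContact_strictMono {n : ℕ} (A : Finset (Fin n)) : StrictMono (lowContact A) := by
  intro i j hij
  refine Nat.add_lt_add_of_lt_of_le (enum_strictMono A hij) (Nat.mul_le_mul_left n ?_)
  split_ifs <;> omega

theorem lowContact_mod {n : ℕ} (A : Finset (Fin n)) {i : ℕ} (hi : i < A.card) :
    lowContact A i % n = enum A i := by
  rw [lowContact, Nat.add_mul_mod_self_left, Nat.mod_eq_of_lt (enum_lt A hi)]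

/-- The copies of `j` on the diagonal. -/
def coatomContact {n : ℕ} (j : Fin n) (i : ℕ) : ℕ := j + n * i

theorem coatomContact_strictMono {n : ℕ} (j : Fin n) : StrictMono (coatomContact j) := by
  intro a b hab
  have : n * a < n * b := Nat.mul_lt_mul_of_pos_left hab j.pos
  simpa [coatomContact] using this

theorem StrictMono.natCast_real {f : ℕ → ℕ} (hf : StrictMono f) :
    StrictMono fun i => (f i : ℝ) := Nat.strictMono_cast.comp hf

/-- The path of a `k`-set, below the diagonal. -/
def lowPath {n : ℕ} (A : Finset (Fin n)) : Set (ℝ × ℝ) :=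
  stair (fun i => (lowContact A i : ℝ)) (A.card - 1)

/-- The path of the complement of `{j}`, above the diagonal. -/
def coatomPath {n : ℕ} (j : Fin n) : Set (ℝ × ℝ) :=
  Prod.swap ⁻¹' stair (fun i => (coatomContact j i : ℝ)) 2

theorem lowPath_inter_lowPath {n k : ℕ} (hk : 3 ≤ k) {A B : Finset (Fin n)} (hA : A.card = k)
    (hB : B.card = k) : (lowPath A ∩ lowPath B).Nonempty := by
  have key : ∀ A : Finset (Fin n), A.card = k → lowContact A 0 < n ∧ n ≤ lowContact A 1 ∧
      lowContact A (k - 1 - 1) < 2 * n ∧ 2 * n ≤ lowContact A (k - 1) := by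
    intro A hA
    have h1 := enum_lt A (i := 0) (by omega)
    have h2 := enum_lt A (i := k - 1 - 1) (by omega)
    refine ⟨?_, ?_, ?_, ?_⟩
    · rw [lowContact, if_neg (by omega), if_neg (by omega)]
      omega
    · rw [lowContact, if_pos (by omega), if_neg (by omega)]
      omega
    · rw [lowContact, if_pos (by omega), if_neg (by omega)]
      omega
    · rw [lowContact, if_pos (by omega), if_pos (by omega)]
      omega
  obtain ⟨a1, a2, a3, a4⟩ := key A hA
  obtain ⟨b1, b2, b3, b4⟩ := key B hB
  rw [lowPath, lowPath, hA, hB]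
  exact stair_inter_stair (N := (n : ℕ)) (M := (2 * n : ℕ))
    (lowContact_strictMono A).natCast_real (lowContact_strictMono B).natCast_real
    (by omega) (Nat.cast_lt.2 a1) (Nat.cast_lt.2 b1) (Nat.cast_le.2 a2) (Nat.cast_le.2 b2)
    (Nat.cast_lt.2 a3) (Nat.cast_lt.2 b3) (Nat.cast_le.2 a4) (Nat.cast_le.2 b4)

theorem coatomPath_inter_coatomPath {n : ℕ} (i j : Fin n) :
    (coatomPath i ∩ coatomPath j).Nonempty := by
  have key : ∀ j : Fin n, coatomContact j 0 < n ∧ n ≤ coatomContact j 1 ∧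
      coatomContact j (2 - 1) < 2 * n ∧ 2 * n ≤ coatomContact j 2 := by
    intro j
    have := j.2
    simp only [coatomContact]
    omega
  obtain ⟨a1, a2, a3, a4⟩ := key i
  obtain ⟨b1, b2, b3, b4⟩ := key j
  obtain ⟨q, hq⟩ := stair_inter_stair (N := (n : ℕ)) (M := (2 * n : ℕ))
    (coatomContact_strictMono i).natCast_real (coatomContact_strictMono j).natCast_real
    le_rfl (Nat.cast_lt.2 a1) (Nat.cast_lt.2 b1) (Nat.cast_le.2 a2) (Nat.cast_le.2 b2)
    (Nat.cast_lt.2 a3) (Nat.cast_lt.2 b3) (Nat.cast_le.2 a4) (Nat.cast_le.2 b4)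
  exact ⟨q.swap, by simpa [coatomPath] using hq⟩

theorem lowPath_inter_coatomPath {n : ℕ} {A : Finset (Fin n)} (hA : 3 ≤ A.card) (j : Fin n) :
    (lowPath A ∩ coatomPath j).Nonempty ↔ j ∈ A := by
  rw [lowPath, coatomPath, stair_inter_swap_stair (lowContact_strictMono A).natCast_real
    (coatomContact_strictMono j).natCast_real (by omega) (by omega), mem_iff_exists_enum]
  constructor
  · rintro ⟨a, ha, b, _, h⟩
    refine ⟨a, by omega, ?_⟩
    rw [← lowContact_mod A (by omega), Nat.cast_injective h, coatomContact,
      Nat.add_mul_mod_self_left, Nat.mod_eq_of_lt j.2]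
  · rintro ⟨a, ha, h⟩
    refine ⟨a, by omega, (if 1 ≤ a then 1 else 0) + if A.card ≤ a + 1 then 1 else 0, ?_, ?_⟩
    · split_ifs <;> omega
    · rw [lowContact, coatomContact, h]

theorem exists_representation {k n : ℕ} (hk : 3 ≤ k) (hkn : k + 1 < n) :
    ∃ R : LayerPoset k (n - 1) n → Set (ℝ × ℝ),
      IsVPGRepresentation (2 * k - 3) (layerCocompGraph k (n - 1) n) R := by
  classical
  let R : LayerPoset k (n - 1) n → Set (ℝ × ℝ) := fun v =>
    if h : ∃ j, v = coatom j then coatomPath h.choose else lowPath v.1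
  have hRc : ∀ j, R (coatom j) = coatomPath j := by
    intro j
    have h : ∃ i : Fin n, (coatom j : LayerPoset k (n - 1) n) = coatom i := ⟨j, rfl⟩
    change dite _ _ _ = _
    rw [dif_pos h, ← coatom_injective h.choose_spec]
  have hRl : ∀ A hA, R (lowVertex A hA) = lowPath A := by
    intro A hA
    exact dif_neg fun ⟨j, hj⟩ => lowVertex_ne_coatom hkn hA j hj
  refine ⟨R, fun v => ?_, fun u v huv => ?_⟩
  · rcases layer_cases (by omega) v with ⟨A, hA, rfl⟩ | ⟨j, rfl⟩
    · rw [hRl]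
      exact isBendPath_stair (lowContact_strictMono A).natCast_real (by omega) (by omega)
    · rw [hRc]
      exact (isBendPath_stair (coatomContact_strictMono j).natCast_real (by omega)
        (by omega)).swap
  · rcases layer_cases (by omega) u with ⟨A, hA, rfl⟩ | ⟨i, rfl⟩ <;>
      rcases layer_cases (by omega) v with ⟨B, hB, rfl⟩ | ⟨j, rfl⟩
    · rw [hRl, hRl]
      exact iff_of_true (lowPath_inter_lowPath hk hA hB)
        (adj_of_card_eq (hA.trans hB.symm) huv)
    · rw [hRl, hRc, adj_lowVertex_coatom hkn, lowPath_inter_coatomPath (by omega)]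
    · rw [hRl, hRc, SimpleGraph.adj_comm, adj_lowVertex_coatom hkn, Set.inter_comm,
        lowPath_inter_coatomPath (by omega)]
    · rw [hRc, hRc]
      exact iff_of_true (coatomPath_inter_coatomPath i j)
        (adj_of_card_eq ((card_coatom i).trans (card_coatom j).symm) huv)

/-! ### Few bends do not suffice: counting order types -/

/-- The position of `x` relative to the finite set `C`, as a number between `0` and `2 * C.card`:
it tells which elements of `C` are below `x` and which of them are equal to `x`. -/
noncomputable def position (C : Finset ℝ) (x : ℝ) : ℕ :=
  (C.filter (· < x)).card + (C.filter (· ≤ x)).card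

theorem position_le (C : Finset ℝ) (x : ℝ) : position C x ≤ 2 * C.card := by
  have h1 := Finset.card_filter_le C (· < x)
  have h2 := Finset.card_filter_le C (· ≤ x)
  unfold position
  omega

theorem le_iff_of_position_eq {C : Finset ℝ} {x y : ℝ} (h : position C x = position C y) {c : ℝ}
    (hc : c ∈ C) : (c ≤ x ↔ c ≤ y) ∧ (x ≤ c ↔ y ≤ c) := by
  wlog hxy : x ≤ y generalizing x y
  · have := this h.symm (le_of_not_ge hxy)
    exact ⟨this.1.symm, this.2.symm⟩
  have s1 : C.filter (· < x) ⊆ C.filter (· < y) :=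
    Finset.monotone_filter_right C fun z _ hz => lt_of_lt_of_le hz hxy
  have s2 : C.filter (· ≤ x) ⊆ C.filter (· ≤ y) :=
    Finset.monotone_filter_right C fun z _ hz => le_trans hz hxy
  have c1 := Finset.card_le_card s1
  have c2 := Finset.card_le_card s2
  unfold position at h
  have e1 := Finset.eq_of_subset_of_card_le s1 (by omega)
  have e2 := Finset.eq_of_subset_of_card_le s2 (by omega)
  have m1 : c ∈ C.filter (· < x) ↔ c ∈ C.filter (· < y) := by rw [e1]
  have m2 : c ∈ C.filter (· ≤ x) ↔ c ∈ C.filter (· ≤ y) := by rw [e2]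
  simp only [Finset.mem_filter, hc, true_and] at m1 m2
  exact ⟨m2, by rw [← not_lt, ← not_lt, m1]⟩

theorem uIcc_inter_uIcc_nonempty_iff {a b c d : ℝ} :
    (Set.uIcc a b ∩ Set.uIcc c d).Nonempty ↔
      ((c ≤ a ∨ d ≤ a) ∨ (c ≤ b ∨ d ≤ b)) ∧ ((a ≤ c ∨ a ≤ d) ∨ (b ≤ c ∨ b ≤ d)) := by
  rw [Set.uIcc, Set.uIcc, Set.Icc_inter_Icc, Set.nonempty_Icc, sup_le_iff, le_inf_iff, le_inf_iff]
  have h1 : a ⊓ b ≤ a ⊔ b := inf_le_sup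
  have h2 : c ⊓ d ≤ c ⊔ d := inf_le_sup
  simp only [h1, h2, true_and, and_true, inf_le_iff, le_sup_iff]
  tauto

theorem uIcc_inter_nonempty_congr {C : Finset ℝ} {a b a' b' c d : ℝ} (hc : c ∈ C) (hd : d ∈ C)
    (ha : position C a = position C a') (hb : position C b = position C b') :
    (Set.uIcc a b ∩ Set.uIcc c d).Nonempty ↔ (Set.uIcc a' b' ∩ Set.uIcc c d).Nonempty := by
  simp only [uIcc_inter_uIcc_nonempty_iff, (le_iff_of_position_eq ha hc).1,
    (le_iff_of_position_eq ha hc).2, (le_iff_of_position_eq ha hd).1,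
    (le_iff_of_position_eq ha hd).2, (le_iff_of_position_eq hb hc).1,
    (le_iff_of_position_eq hb hc).2, (le_iff_of_position_eq hb hd).1,
    (le_iff_of_position_eq hb hd).2]

theorem path_inter_path_nonempty_iff {m l : ℕ} {p q : ℕ → ℝ × ℝ} (hp : IsRectilinearPath m p)
    (hq : IsRectilinearPath l q) :
    ((⋃ i ∈ Finset.range m, segment ℝ (p i) (p (i + 1))) ∩
        ⋃ j ∈ Finset.range l, segment ℝ (q j) (q (j + 1))).Nonempty ↔
      ∃ i < m, ∃ j < l,
        (Set.uIcc (p i).1 (p (i + 1)).1 ∩ Set.uIcc (q j).1 (q (j + 1)).1).Nonempty ∧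
        (Set.uIcc (p i).2 (p (i + 1)).2 ∩ Set.uIcc (q j).2 (q (j + 1)).2).Nonempty := by
  constructor
  · rintro ⟨z, h1, h2⟩
    simp only [Set.mem_iUnion, Finset.mem_range, exists_prop] at h1 h2
    obtain ⟨i, hi, h1⟩ := h1
    obtain ⟨j, hj, h2⟩ := h2
    rw [hp.segment_eq hi] at h1
    rw [hq.segment_eq hj] at h2
    exact ⟨i, hi, j, hj, ⟨z.1, h1.1, h2.1⟩, ⟨z.2, h1.2, h2.2⟩⟩
  · rintro ⟨i, hi, j, hj, ⟨x, h1, h2⟩, ⟨y, h3, h4⟩⟩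
    refine ⟨(x, y), ?_, ?_⟩ <;> simp only [Set.mem_iUnion, Finset.mem_range, exists_prop]
    · exact ⟨i, hi, by rw [hp.segment_eq hi]; exact ⟨h1, h3⟩⟩
    · exact ⟨j, hj, by rw [hq.segment_eq hj]; exact ⟨h2, h4⟩⟩

/-- In a representation by `t`-bend paths, a `k`-set is determined by the number of segments of its
path and the positions of the corner coordinates relative to those of the coatom paths. The right
hand side counts the possible values of these data. -/
theorem choose_le_of_representation {t k n : ℕ} (hkn : k + 1 < n)
    {R : LayerPoset k (n - 1) n → Set (ℝ × ℝ)}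
    (hR : IsVPGRepresentation t (layerCocompGraph k (n - 1) n) R) :
    n.choose k ≤ (t + 2) * (4 * (t + 2) * n + 1) ^ (2 * (t + 2)) := by
  classical
  obtain ⟨hpath, hadj⟩ := hR
  choose len p hlen hp hRp using hpath
  let coords : (ℝ × ℝ → ℝ) → Finset ℝ := fun f =>
    (Finset.univ : Finset (Fin n × Fin (t + 2))).image fun x => f (p (coatom x.1) x.2)
  let C : Finset ℝ := coords Prod.fst ∪ coords Prod.snd
  have hcoords : ∀ f, (coords f).card ≤ n * (t + 2) := fun f => by
    refine Finset.card_image_le.trans ?_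
    simp
  have hC : C.card ≤ 2 * (t + 2) * n := by
    refine (Finset.card_union_le _ _).trans ?_
    have h1 := hcoords Prod.fst
    have h2 := hcoords Prod.snd
    nlinarith
  have hmem : ∀ j : Fin n, ∀ i < t + 2,
      (p (coatom j) i).1 ∈ C ∧ (p (coatom j) i).2 ∈ C := by
    intro j i hi
    exact ⟨Finset.mem_union_left _ (Finset.mem_image.2 ⟨(j, ⟨i, hi⟩), Finset.mem_univ _, rfl⟩),
      Finset.mem_union_right _ (Finset.mem_image.2 ⟨(j, ⟨i, hi⟩), Finset.mem_univ _, rfl⟩)⟩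
  have hpos : ∀ x, position C x < 4 * (t + 2) * n + 1 := fun x => by
    have := position_le C x
    linarith
  let code : {A : Finset (Fin n) // A.card = k} →
      Fin (t + 2) × (Fin (t + 2) → Fin (4 * (t + 2) * n + 1) × Fin (4 * (t + 2) * n + 1)) :=
    fun A => (⟨len (lowVertex A.1 A.2), by have := hlen (lowVertex A.1 A.2); omega⟩,
      fun i => (⟨_, hpos (p (lowVertex A.1 A.2) i).1⟩, ⟨_, hpos (p (lowVertex A.1 A.2) i).2⟩))
  have hcode : Function.Injective code := by
    rintro ⟨A, hA⟩ ⟨B, hB⟩ h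
    have hl : len (lowVertex A hA) = len (lowVertex B hB) :=
      congrArg Fin.val (congrArg Prod.fst h)
    have hq : ∀ i < t + 2,
        position C (p (lowVertex A hA) i).1 = position C (p (lowVertex B hB) i).1 ∧
        position C (p (lowVertex A hA) i).2 = position C (p (lowVertex B hB) i).2 := by
      intro i hi
      have h1 := congrFun (congrArg Prod.snd h) ⟨i, hi⟩
      exact ⟨congrArg Fin.val (congrArg Prod.fst h1), congrArg Fin.val (congrArg Prod.snd h1)⟩
    refine Subtype.ext (Finset.ext fun j => ?_)
    change j ∈ A ↔ j ∈ B
    rw [← adj_lowVertex_coatom hkn hA, ← adj_lowVertex_coatom hkn hB,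
      ← hadj _ _ (lowVertex_ne_coatom hkn hA j), ← hadj _ _ (lowVertex_ne_coatom hkn hB j),
      hRp, hRp (lowVertex B hB), hRp (coatom j), path_inter_path_nonempty_iff (hp _) (hp _),
      path_inter_path_nonempty_iff (hp _) (hp _), hl]
    refine exists_congr fun i => and_congr_right fun hi => exists_congr fun l =>
      and_congr_right fun hlt => ?_
    have hi' := hlen (lowVertex B hB)
    have hl' := hlen (coatom j)
    have q1 := hq i (by omega)
    have q2 := hq (i + 1) (by omega)
    have c1 := hmem j l (by omega)
    have c2 := hmem j (l + 1) (by omega)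
    exact and_congr (uIcc_inter_nonempty_congr c1.1 c2.1 q1.1 q2.1)
      (uIcc_inter_nonempty_congr c1.2 c2.2 q1.2 q2.2)
  have hcard := Fintype.card_le_of_injective code hcode
  rw [Fintype.card_finset_len, Fintype.card_fin] at hcard
  simp only [Fintype.card_prod, Fintype.card_fin, Fintype.card_fun] at hcard
  rwa [← pow_two, ← pow_mul] at hcard

theorem lt_choose_of_large {t n : ℕ}
    (hn : (t + 2) * (10 * (t + 2)) ^ (2 * (t + 2)) * (2 * t + 16).factorial +
      2 * (2 * t + 16) < n) :
    (t + 2) * (4 * (t + 2) * n + 1) ^ (2 * (t + 2)) < n.choose (2 * t + 16) := by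
  generalize hk : 2 * t + 16 = k at hn ⊢
  generalize hM : (t + 2) * (10 * (t + 2)) ^ (2 * (t + 2)) * k.factorial = M at hn
  obtain ⟨a, ha⟩ : ∃ a, n + 1 - k = a := ⟨_, rfl⟩
  have ha1 : M < a := by omega
  have hna : n ≤ 2 * a := by omega
  have h1 : 4 * (t + 2) * n + 1 ≤ 10 * (t + 2) * a := by
    have : 1 ≤ (t + 2) * a := Nat.mul_pos (by omega) (by omega)
    nlinarith
  have h2 : a ^ k ≤ n.choose k * k.factorial := by
    have := Nat.pow_sub_le_descFactorial n k
    rw [Nat.descFactorial_eq_factorial_mul_choose, ha, mul_comm] at this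
    exact this
  refine lt_of_mul_lt_mul_right (lt_of_lt_of_le ?_ h2) (Nat.zero_le k.factorial)
  have h0 : 0 < a := by omega
  calc (t + 2) * (4 * (t + 2) * n + 1) ^ (2 * (t + 2)) * k.factorial
      ≤ (t + 2) * (10 * (t + 2) * a) ^ (2 * (t + 2)) * k.factorial := by gcongr
    _ = M * a ^ (2 * (t + 2)) := by rw [← hM, mul_pow _ a]; ring
    _ < a * a ^ (2 * (t + 2)) := by gcongr
    _ = a ^ (2 * (t + 2) + 1) := by ring
    _ ≤ a ^ k := Nat.pow_le_pow_right h0 (by omega)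

/-! ### The dimension of the two levels -/

theorem exists_linearOrder_extending {X : Type*} (r : X → X → Prop) [IsPartialOrder X r] :
    ∃ L : LinearOrder X, ∀ a b, r a b → L.le a b := by
  obtain ⟨s, hs, hle⟩ := extend_partialOrder r
  exact ⟨{ le := s, lt := fun a b => s a b ∧ ¬ s b a, le_refl := hs.refl, le_trans := hs.trans,
           le_antisymm := hs.antisymm, le_total := hs.total,
           toDecidableLE := Classical.decRel _ }, hle⟩

/-- An order on a finite set is the intersection of linear orders: for each pair `x`, `y` with
`¬ x < y`, the order obtained by placing `y` below `x` extends to a linear order. -/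
theorem exists_isRealizer {X : Type*} [Finite X] [Nonempty X] (P : PartialOrder X) :
    ∃ d, 0 < d ∧ ∃ L : Fin d → LinearOrder X, IsRealizer P L := by
  classical
  have key : ∀ z : X × X, ∃ L : LinearOrder X, (∀ a b, P.le a b → L.le a b) ∧
      (¬ P.lt z.1 z.2 → ¬ L.lt z.1 z.2) := by
    rintro ⟨x, y⟩
    by_cases hxy : P.lt x y
    · obtain ⟨L, hL⟩ := exists_linearOrder_extending P.le
      exact ⟨L, hL, fun h => absurd hxy h⟩
    · let r : X → X → Prop := fun a b => a ≤ b ∨ (a ≤ y ∧ x ≤ b)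
      have hr : IsPartialOrder X r :=
        { refl := fun a => Or.inl le_rfl
          trans := by
            rintro a b c (h1 | ⟨h1, h2⟩) (h3 | ⟨h3, h4⟩)
            · exact Or.inl (h1.trans h3)
            · exact Or.inr ⟨h1.trans h3, h4⟩
            · exact Or.inr ⟨h1, h2.trans h3⟩
            · exact Or.inr ⟨h1, h4⟩
          antisymm := by
            have hle : x ≤ y → x = y := fun h => h.lt_or_eq.resolve_left hxy
            rintro a b (h1 | ⟨h1, h2⟩) (h3 | ⟨h3, h4⟩)
            · exact le_antisymm h1 h3
            · have e := hle (h4.trans (h1.trans h3))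
              subst e
              exact le_antisymm h1 (h3.trans h4)
            · have e := hle (h2.trans (h3.trans h1))
              subst e
              exact le_antisymm (h1.trans h2) h3
            · have e := hle (h2.trans h3)
              subst e
              exact le_antisymm (h1.trans h2) (h3.trans h4) }
      obtain ⟨L, hL⟩ := exists_linearOrder_extending r
      refine ⟨L, fun a b hab => hL a b (Or.inl hab), fun _ h => ?_⟩
      exact ((L.lt_iff_le_not_ge x y).1 h).2 (hL y x (Or.inr ⟨le_rfl, le_rfl⟩))
  choose L hL1 hL2 using key
  cases nonempty_fintype X
  let e := (Fintype.equivFin (X × X)).symm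
  refine ⟨Fintype.card (X × X), Fintype.card_pos, fun i => L (e i), fun x y => ⟨?_, ?_⟩⟩
  · intro hxy i
    exact @lt_of_le_of_ne X (L (e i)).toPartialOrder x y
      (hL1 _ _ _ (@le_of_lt X P.toPreorder _ _ hxy))
      (@ne_of_lt X P.toPreorder _ _ hxy)
  · intro h
    by_contra hxy
    obtain ⟨i, hi⟩ := e.surjective (x, y)
    have h1 : (L (e i)).lt x y := h i
    rw [hi] at h1
    exact hL2 (x, y) hxy h1

/-- In a linear order, at most `k` elements have fewer than `k` predecessors. -/
theorem card_initial_le {J : Type*} [Fintype J] [DecidableEq J] (r : J → J → Prop)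
    [IsStrictTotalOrder J r] [DecidableRel r] (k : ℕ) :
    (Finset.univ.filter fun j => (Finset.univ.filter fun i => r i j).card < k).card ≤ k := by
  have hlt : ∀ i j, r i j →
      (Finset.univ.filter fun l => r l i).card < (Finset.univ.filter fun l => r l j).card := by
    intro i j hij
    refine Finset.card_lt_card (Finset.ssubset_iff_subset_ne.2 ⟨?_, fun h => ?_⟩)
    · exact Finset.monotone_filter_right _ fun l _ hl => _root_.trans hl hij
    · have : i ∈ Finset.univ.filter fun l => r l i := by
        rw [h]
        simpa using hij
      exact irrefl i (by simpa using this)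
  calc _ ≤ (Finset.range k).card := by
        refine Finset.card_le_card_of_injOn
          (fun j => (Finset.univ.filter fun i => r i j).card) (fun j hj => ?_) ?_
        · simpa using hj
        · intro i _ j _ h
          rcases trichotomous_of r i j with h1 | h1 | h1
          · exact absurd h (hlt i j h1).ne
          · exact h1
          · exact absurd h (hlt j i h1).ne'
    _ = k := Finset.card_range k

/-- If `d` linear orders on the vertices realize the inclusion order, then `n ≤ d * k`: otherwise
some coatom, the complement of `{j}`, is preceded by at least `k` other coatoms in all `d` orders,
so it follows every `k`-set that contains `j`. -/
theorem le_mul_of_realizes {k n d : ℕ} (hk : 0 < k) (hkn : k + 1 < n)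
    (r : Fin d → LayerPoset k (n - 1) n → LayerPoset k (n - 1) n → Prop)
    [∀ i, IsStrictTotalOrder _ (r i)]
    (h1 : ∀ A hA j, j ∉ A → ∀ i, r i (lowVertex A hA) (coatom j))
    (h2 : ∀ A hA j, j ∈ A → ∃ i, ¬ r i (lowVertex A hA) (coatom j)) : n ≤ d * k := by
  classical
  let s : Fin d → Fin n → Fin n → Prop := fun i a b => r i (coatom a) (coatom b)
  have hs : ∀ i, IsStrictTotalOrder (Fin n) (s i) := fun i =>
    { trichotomous := fun a b hab hba => coatom_injective
        (((trichotomous_of (r i) (coatom a) (coatom b)).resolve_left hab).resolve_right hba)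
      irrefl := fun a => irrefl (r := r i) _
      trans := fun a b c => _root_.trans (r := r i) }
  by_contra hnd
  let S : Fin d → Finset (Fin n) := fun i =>
    Finset.univ.filter fun j => (Finset.univ.filter fun l => s i l j).card < k
  have hcard : (Finset.univ.biUnion S).card < (Finset.univ : Finset (Fin n)).card := by
    have : (Finset.univ.biUnion S).card ≤ (Finset.univ : Finset (Fin d)).card * k :=
      Finset.card_biUnion_le_card_mul _ _ _ fun i _ => card_initial_le (s i) k
    rw [Finset.card_fin] at this ⊢
    omega
  obtain ⟨j, _, hj⟩ := Finset.exists_mem_notMem_of_card_lt_card hcard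
  have hj' : ∀ i, k ≤ (Finset.univ.filter fun l => s i l j).card := by
    intro i
    by_contra h
    exact hj (Finset.mem_biUnion.2 ⟨i, Finset.mem_univ i,
      Finset.mem_filter.2 ⟨Finset.mem_univ j, not_le.1 h⟩⟩)
  obtain ⟨A, hjA, -, hA⟩ := Finset.exists_subsuperset_card_eq
    (Finset.singleton_subset_iff.2 (Finset.mem_univ j)) (n := k)
    (by rw [Finset.card_singleton]; exact hk)
    (by rw [Finset.card_fin]; omega)
  rw [Finset.singleton_subset_iff] at hjA
  obtain ⟨i, hi⟩ := h2 A hA j hjA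
  have hlt : (A.erase j).card < (Finset.univ.filter fun l => s i l j).card := by
    rw [Finset.card_erase_of_mem hjA]
    have := hj' i
    omega
  obtain ⟨l, hl, hlA⟩ := Finset.exists_mem_notMem_of_card_lt_card hlt
  have hlj : s i l j := (Finset.mem_filter.1 hl).2
  have hlne : l ≠ j := by
    rintro rfl
    exact irrefl (r := s i) l hlj
  exact hi (_root_.trans (h1 A hA l (fun h => hlA (Finset.mem_erase.2 ⟨hlne, h⟩)) i) hlj)

/-- The comparability graph of the two levels is bipartite and connected, so it has only two
transitive orientations. -/
theorem orientation_of_comparabilityGraph_eq {k n : ℕ} (hkn : k + 1 < n)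
    {P : PartialOrder (LayerPoset k (n - 1) n)}
    (hP : comparabilityGraph P = (layerCocompGraph k (n - 1) n)ᶜ) :
    (∀ A hA j, P.lt (lowVertex A hA) (coatom j) ↔ j ∉ A) ∨
      ∀ A hA j, P.lt (coatom j) (lowVertex A hA) ↔ j ∉ A := by
  have hcomp : ∀ u v, (P.lt u v ∨ P.lt v u) ↔ (u < v ∨ v < u) := by
    intro u v
    rw [layerCocompGraph_compl] at hP
    exact iff_of_eq (congrArg (fun G => G.Adj u v) hP)
  have hlow : ∀ A hA j, (P.lt (lowVertex A hA) (coatom j) ∨ P.lt (coatom j) (lowVertex A hA)) ↔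
      j ∉ A := by
    intro A hA j
    rw [hcomp, lowVertex_lt_coatom hkn, or_iff_left (not_coatom_lt_lowVertex hkn hA)]
  have hcoatom : ∀ i j, ¬ P.lt (coatom i) (coatom j) := by
    intro i j h
    have hc : (coatom (k := k) i).1.card = (coatom (k := k) j).1.card :=
      (card_coatom i).trans (card_coatom j).symm
    rcases (hcomp _ _).1 (Or.inl h) with h | h
    · exact not_lt_of_card_eq hc h
    · exact not_lt_of_card_eq hc.symm h
  have hlowlow : ∀ A hA B hB, ¬ P.lt (lowVertex A hA) (lowVertex B hB) := by
    intro A hA B hB h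
    have hc : A.card = B.card := hA.trans hB.symm
    rcases (hcomp _ _).1 (Or.inl h) with h | h
    · exact not_lt_of_card_eq (u := lowVertex A hA) (v := lowVertex B hB) hc h
    · exact not_lt_of_card_eq (u := lowVertex B hB) (v := lowVertex A hA) hc.symm h
  -- All coatoms are oriented alike, since two coatoms have a common neighbour.
  have hup : ∀ A hA B hB i j, P.lt (lowVertex A hA) (coatom i) →
      ¬ P.lt (coatom j) (lowVertex B hB) := by
    intro A hA B hB i j h1 h2
    have hsub : ({i, j} : Finset (Fin n)).card ≤ 2 := Finset.card_le_two
    obtain ⟨D, hD1, hD⟩ := Finset.exists_subset_card_eq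
      (s := ({i, j} : Finset (Fin n))ᶜ) (n := k)
      (by rw [Finset.card_compl, Fintype.card_fin]; omega)
    have hDi : i ∉ D := fun h => by simpa using hD1 h
    have hDj : j ∉ D := fun h => by simpa using hD1 h
    rcases (hlow D hD i).2 hDi with h3 | h3
    · rcases (hlow D hD j).2 hDj with h4 | h4
      · exact hlowlow _ _ _ _ (@lt_trans _ P.toPreorder _ _ _ h4 h2)
      · exact hcoatom _ _ (@lt_trans _ P.toPreorder _ _ _ h4 h3)
    · exact hlowlow _ _ _ _ (@lt_trans _ P.toPreorder _ _ _ h1 h3)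
  by_cases hex : ∃ A hA i, P.lt (lowVertex A hA) (coatom i)
  · obtain ⟨A, hA, i, h⟩ := hex
    exact Or.inl fun B hB j => by rw [← hlow B hB j, or_iff_left (hup A hA B hB i j h)]
  · push Not at hex
    exact Or.inr fun B hB j => by rw [← hlow B hB j, or_iff_right (hex B hB j)]

theorem le_mul_of_isRealizer {k n d : ℕ} (hk : 0 < k) (hkn : k + 1 < n)
    {P : PartialOrder (LayerPoset k (n - 1) n)}
    (hP : comparabilityGraph P = (layerCocompGraph k (n - 1) n)ᶜ)
    {L : Fin d → LinearOrder (LayerPoset k (n - 1) n)} (hL : IsRealizer P L) : n ≤ d * k := by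
  have hst : ∀ i, IsStrictTotalOrder _ (L i).lt := fun i =>
    @instIsStrictTotalOrderLt _ (L i)
  rcases orientation_of_comparabilityGraph_eq hkn hP with h | h
  · refine le_mul_of_realizes hk hkn (fun i => (L i).lt) ?_ ?_
    · exact fun A hA j hj => (hL _ _).1 ((h A hA j).2 hj)
    · intro A hA j hj
      by_contra hc
      push Not at hc
      exact (h A hA j).1 ((hL _ _).2 hc) hj
  · have hst' : ∀ i, IsStrictTotalOrder _ (Function.swap (L i).lt) := fun i =>
      { trichotomous := fun a b h1 h2 => (hst i).trichotomous a b h2 h1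
        irrefl := fun a => (hst i).irrefl a
        trans := fun a b c h1 h2 => (hst i).trans _ _ _ h2 h1 }
    refine le_mul_of_realizes hk hkn (fun i => Function.swap (L i).lt) ?_ ?_
    · exact fun A hA j hj => (hL _ _).1 ((h A hA j).2 hj)
    · intro A hA j hj
      by_contra hc
      push Not at hc
      exact (h A hA j).1 ((hL _ _).2 hc) hj

theorem le_cocompDim_mul {k n : ℕ} (hk : 0 < k) (hkn : k + 1 < n) :
    n ≤ cocompDim (layerCocompGraph k (n - 1) n) * k := by
  have : Nonempty (LayerPoset k (n - 1) n) := ⟨coatom ⟨0, by omega⟩⟩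
  -- Both infima are over non-empty sets, so they are attained.
  obtain ⟨P, hP, hdim⟩ := Nat.sInf_mem (s := {d : ℕ | ∃ P : PartialOrder (LayerPoset k (n - 1) n),
    comparabilityGraph P = (layerCocompGraph k (n - 1) n)ᶜ ∧ d = posetDim P})
    ⟨_, _, (layerCocompGraph_compl k (n - 1) n).symm, rfl⟩
  obtain ⟨-, L, hL⟩ := Nat.sInf_mem (s := {d : ℕ | 0 < d ∧
    ∃ L : Fin d → LinearOrder (LayerPoset k (n - 1) n), IsRealizer P L}) (exists_isRealizer P)
  have h := le_mul_of_isRealizer hk hkn hP hL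
  rw [cocompDim, hdim]
  exact h

/-! ### The gap between bend number and dimension -/

theorem theorem1 (t m : ℕ) :
    ∃ n : ℕ, 2 * t + 16 + 1 < n ∧
      IsCocomparabilityGraph (layerCocompGraph (2 * t + 16) (n - 1) n) ∧
      t < bend (layerCocompGraph (2 * t + 16) (n - 1) n) ∧
      bend (layerCocompGraph (2 * t + 16) (n - 1) n) ≤ 4 * t + 29 ∧
      (m : ℤ) < (cocompDim (layerCocompGraph (2 * t + 16) (n - 1) n) : ℤ) -
        (bend (layerCocompGraph (2 * t + 16) (n - 1) n) : ℤ) := by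
  -- `n` exceeds the bound of the counting argument and the bound `(4 * t + 29 + m) * k` that
  -- forces the dimension above `4 * t + 29 + m`.
  obtain ⟨n, hn1, hn2⟩ : ∃ n,
      (t + 2) * (10 * (t + 2)) ^ (2 * (t + 2)) * (2 * t + 16).factorial + 2 * (2 * t + 16) < n ∧
      (4 * t + 29 + m) * (2 * t + 16) < n :=
    ⟨_, Nat.lt_succ_of_le (Nat.le_add_right _ _), Nat.lt_succ_of_le (Nat.le_add_left _ _)⟩
  have hkn : 2 * t + 16 + 1 < n := by omega
  obtain ⟨R, hR⟩ := exists_representation (by omega) hkn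
  rw [show 2 * (2 * t + 16) - 3 = 4 * t + 29 by omega] at hR
  have hle : bend (layerCocompGraph (2 * t + 16) (n - 1) n) ≤ 4 * t + 29 := Nat.sInf_le ⟨R, hR⟩
  have hlt : t < bend (layerCocompGraph (2 * t + 16) (n - 1) n) := by
    by_contra h
    obtain ⟨S, hS, hadj⟩ := Nat.sInf_mem (s := {k : ℕ | ∃ R : _ → Set (ℝ × ℝ),
      IsVPGRepresentation k (layerCocompGraph (2 * t + 16) (n - 1) n) R}) ⟨_, R, hR⟩
    have h1 := choose_le_of_representation (t := t) hkn
      ⟨fun v => (hS v).mono (not_lt.1 h), hadj⟩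
    exact absurd h1 (not_le.2 (lt_choose_of_large hn1))
  have hdim : 4 * t + 29 + m < cocompDim (layerCocompGraph (2 * t + 16) (n - 1) n) :=
    lt_of_mul_lt_mul_right (hn2.trans_le (le_cocompDim_mul (by omega) hkn)) (Nat.zero_le _)
  exact ⟨n, hkn, ⟨_, (layerCocompGraph_compl _ _ _).symm⟩, hlt, hle, by omega⟩
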